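/- Let $\mathbb K=\{0,1\}^{\mathbb N}$ be the dyadic Cantor set with the metric $d(x,y)=2^{-n}$, where $n$ is the length of the longest common prefix of $x\ne y$. Let $I_n(x)$ be the cylinder of generation $n$ containing $x$, and $\mathcal F_n$ the set of the $2^n$ cylinders of generation $n$. For a Borel probability measure $\mu$ on $\mathbb K$ put $$\dim_*\mu=\inf\{\dim_{\mathcal H}E: E\subset\mathbb K \text{ Borel},\ \mu(E)>0\},\qquad \dim^*\mu=\inf\{\dim_{\mathcal H}E: E\subset\mathbb K\text{ Borel},\ \mu(\mathbb K\setminus E)=0\},$$ let $\mathrm{Dim}_*\mu$, $\mathrm{Dim}^*\mu$ be defined in the same way with the packing dimension in place of the Hausdorff dimension, and let $h_*(\mu)$, $h^*(\mu)$ be the lower and upper limits of $-\frac1n\sum_{I\in\mathcal F_n}\mu(I)\log\mu(I)$ as $n\to\infty$. The measure $\mu$ is exact if $\dim_*\mu=\dim^*\mu$, and dyadic doubling if there is a constant $C$ with $\mu(I_n(x))\le C\,\mu(I_{n+1}(x))$ for all $n\ge0$ and $x\in\mathbb K$. **Theorem.** For every $\varepsilon>0$ there are two dyadic doubling, exact Borel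 probability measures $\mu,\nu$ on $\mathbb K$ such that, with $$X_n(x)=\log\frac{\mu(I_n(x))}{\mu(I_{n-1}(x))},\qquad Y_n(x)=\log\frac{\nu(I_n(x))}{\nu(I_{n-1}(x))}\qquad(n\ge1),$$ one has $$\sup_{n\ge1}\|X_n-Y_n\|_\infty<\varepsilon\qquad\text{and nevertheless}\qquad |\dim_*\mu-\dim_*\nu|>\tfrac14 .$$ Moreover $\mu$ and $\nu$ can be chosen so that, in addition, each $m\in\{\mu,\nu\}$ satisfies $$\dim_*m=\dim^*m=\frac{h_*(m)}{\log 2}\qquad\text{and}\qquad \mathrm{Dim}_*m=\mathrm{Dim}^*m=\frac{h^*(m)}{\log2}.$$ Consequently the continuity of $\dim_*$ in the transition weights, which holds for measures defined by non-homogeneous Markov chains, fails for general measures: it is not true that for every $\eta>0$ there is $\zeta>0$ such that $|\dim_*\mu-\dim_*\nu|<\eta$ for all dyadic doubling, exact Borel probability measures $\mu,\nu$ on $\mathbb K$ with $$\sup_{n\ge1,\ x\in\mathbb K}\left|\frac{\mu(I_n(x))}{\mu(I_{n-1}(x))}-\frac{\nu(I_n(x))}{\nu(I_{n-1}(x))}\right|<\zeta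 .$$ -/

import Mathlib

open MeasureTheory Filter Topology
open scoped ENNReal NNReal

namespace DyadicCantor

/-- The limit set of the dyadic tree: infinite words in the digits `0` (`false`) and `1` (`true`). -/
abbrev Cantor : Type := ℕ → Bool

/-- The dyadic metric `d(x, y) = 2⁻ⁿ`, where `n` is the length of the longest common prefix of
`x ≠ y`. A cylinder of generation `n` has diameter `2⁻ⁿ`; the topology is the product topology. -/
noncomputable instance cantorMetric : MetricSpace Cantor :=
  PiNat.metricSpaceOfDiscreteUniformity fun _ => rfl

/-- The mass of `I_n(x)`, the cylinder of generation `n` that contains `x`. -/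
noncomputable def mass (μ : Measure Cantor) (n : ℕ) (x : Cantor) : ℝ :=
  μ.real (PiNat.cylinder x n)

/-- The cylinder of generation `n` that is coded by the finite word `w`. -/
def wordCylinder {n : ℕ} (w : Fin n → Bool) : Set Cantor :=
  {x | ∀ i : Fin n, x i = w i}

/-- Dyadic doubling: the mass of a cylinder is at most a constant times the mass of each of its two
children. -/
def IsDyadicDoubling (μ : Measure Cantor) : Prop :=
  ∃ C : ℝ≥0, ∀ (n : ℕ) (x : Cantor),
    μ (PiNat.cylinder x n) ≤ C * μ (PiNat.cylinder x (n + 1))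

/-- The transition weight `μ(I_n(x)) / μ(I_{n-1}(x))`, for `n ≥ 1` (it is trivial for `n = 0`). -/
noncomputable def weight (μ : Measure Cantor) (n : ℕ) (x : Cantor) : ℝ :=
  mass μ n x / mass μ (n - 1) x

/-- The random variable `X_n(x) = log (μ(I_n(x)) / μ(I_{n-1}(x)))`, for `n ≥ 1` (and `X_0 = 0`). -/
noncomputable def logRatio (μ : Measure Cantor) (n : ℕ) (x : Cantor) : ℝ :=
  Real.log (weight μ n x)

/-- The lower Hausdorff dimension `dim_* μ`. -/
noncomputable def lowerDim (μ : Measure Cantor) : ℝ≥0∞ :=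
  ⨅ (E : Set Cantor) (_ : MeasurableSet E) (_ : 0 < μ E), dimH E

/-- The upper Hausdorff dimension `dim^* μ`. -/
noncomputable def upperDim (μ : Measure Cantor) : ℝ≥0∞ :=
  ⨅ (E : Set Cantor) (_ : MeasurableSet E) (_ : μ Eᶜ = 0), dimH E

/-- A measure is exact if its lower and upper Hausdorff dimensions coincide. -/
def IsExact (μ : Measure Cantor) : Prop :=
  lowerDim μ = upperDim μ

/-- The number of cylinders of generation `n` that meet `E`. -/
noncomputable def boxCount (n : ℕ) (E : Set Cantor) : ℕ :=
  {w : Fin n → Bool | (E ∩ wordCylinder w).Nonempty}.ncard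

/-- The upper box-counting dimension. -/
noncomputable def upperBoxDim (E : Set Cantor) : ℝ≥0∞ :=
  limsup (fun n : ℕ => ENNReal.ofReal (Real.log (boxCount n E) / (n * Real.log 2))) atTop

/-- The packing (Tricot) dimension: the regularized (countably stable) upper box dimension. -/
noncomputable def packingDim (E : Set Cantor) : ℝ≥0∞ :=
  ⨅ (F : ℕ → Set Cantor) (_ : E ⊆ ⋃ i, F i), ⨆ i, upperBoxDim (F i)

/-- The lower packing dimension `Dim_* μ`. -/
noncomputable def lowerPackingDim (μ : Measure Cantor) : ℝ≥0∞ :=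
  ⨅ (E : Set Cantor) (_ : MeasurableSet E) (_ : 0 < μ E), packingDim E

/-- The upper packing dimension `Dim^* μ`. -/
noncomputable def upperPackingDim (μ : Measure Cantor) : ℝ≥0∞ :=
  ⨅ (E : Set Cantor) (_ : MeasurableSet E) (_ : μ Eᶜ = 0), packingDim E

/-- The normalized entropy `-(1/n) ∑ μ(I) log μ(I)` of the partition into the cylinders `I` of
generation `n`. -/
noncomputable def entropy (μ : Measure Cantor) (n : ℕ) : ℝ :=
  (-1 / (n : ℝ)) *
    ∑ w : Fin n → Bool, Real.log (μ.real (wordCylinder w)) * μ.real (wordCylinder w)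

/-- The lower entropy `h_*(μ)`. -/
noncomputable def lowerEntropy (μ : Measure Cantor) : ℝ :=
  liminf (entropy μ) atTop

/-- The upper entropy `h^*(μ)`. -/
noncomputable def upperEntropy (μ : Measure Cantor) : ℝ :=
  limsup (entropy μ) atTop

/-- `dim_* μ = dim^* μ = h_*(μ)` and `Dim_* μ = Dim^* μ = h^*(μ)`, with the entropies (which are
defined through natural logarithms) expressed in base `2`. -/
def DimensionsEqEntropies (μ : Measure Cantor) : Prop :=
  (lowerDim μ = upperDim μ ∧ upperDim μ = ENNReal.ofReal (lowerEntropy μ / Real.log 2)) ∧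
    (lowerPackingDim μ = upperPackingDim μ ∧
      upperPackingDim μ = ENNReal.ofReal (upperEntropy μ / Real.log 2))

end DyadicCantor

namespace DyadicCantor

/-! The two measures are laws of digit sequences in which a tiny bias is amplified by feedback.
Digits at even positions are independent control bits of bias `c`, respectively `1 - c`, with `c`
slightly above `1/2`. A digit at an odd position is tossed with a fair coin if the ±1 walk of the
control bits seen so far is positive, and otherwise with a fixed coin of bias `p` and small entropy.
Both measures use the same rule at odd positions, so their log-ratios differ only at even positions,
by `|log c - log (1 - c)|`, which is as small as desired. By the law of large numbers the walk
drifts to `+∞` for one measure and to `-∞` for the other, so almost surely the odd digits eventually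
come from a single coin: fair in the first case, of bias `p` in the second.

Hence `-log (mass μ n x) / n` converges almost everywhere to the constant `(H(c) + log 2) / 2`,
respectively `(H(c) + H(p)) / 2`, where `H` is the binary entropy (`ae_tendsto_localEntropy`). For a
doubling measure such convergence determines all dimensions and entropies
(`dimensions_of_tendsto_localEntropy`). With `H(p) < log 2 / 2` the dimensions differ by more than
`1/4`. -/

instance : BorelSpace Cantor := inferInstanceAs (BorelSpace (∀ _ : ℕ, Bool))

/-! ### Cylinders and the mass distribution principle -/

lemma edist_eq_of_ne {x y : Cantor} (h : x ≠ y) :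
    edist x y = (2⁻¹ : ℝ≥0∞) ^ PiNat.firstDiff x y := by
  have h1 : dist x y = (1 / 2 : ℝ) ^ PiNat.firstDiff x y := PiNat.dist_eq_of_ne h
  rw [edist_dist, h1, ENNReal.ofReal_pow (by norm_num), one_div,
    ENNReal.ofReal_inv_of_pos (by norm_num)]
  simp

lemma edist_le_of_mem_cylinder {x y : Cantor} {n : ℕ} (h : y ∈ PiNat.cylinder x n) :
    edist x y ≤ (2⁻¹ : ℝ≥0∞) ^ n := by
  rcases eq_or_ne x y with rfl | hne
  · simp
  · rw [edist_eq_of_ne hne]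
    rw [PiNat.mem_cylinder_comm, PiNat.mem_cylinder_iff_le_firstDiff hne] at h
    exact pow_le_pow_right_of_le_one' (by simp) h

lemma wordCylinder_eq_cylinder {n : ℕ} {w : Fin n → Bool} {x : Cantor} (hx : x ∈ wordCylinder w) :
    wordCylinder w = PiNat.cylinder x n := by
  ext y
  simp only [wordCylinder, Set.mem_ofPred_eq, PiNat.mem_cylinder_iff] at *
  exact ⟨fun h i hi => (h ⟨i, hi⟩).trans (hx ⟨i, hi⟩).symm, fun h i => (h i i.2).trans (hx i)⟩

lemma mem_wordCylinder_self (n : ℕ) (x : Cantor) :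
    x ∈ wordCylinder (fun i : Fin n => x i) := fun _ => rfl

lemma measurableSet_cylinder (x : Cantor) (n : ℕ) : MeasurableSet (PiNat.cylinder x n) :=
  (PiNat.isOpen_cylinder (E := fun _ => Bool) x n).measurableSet

lemma measurableSet_wordCylinder {n : ℕ} (w : Fin n → Bool) : MeasurableSet (wordCylinder w) := by
  rcases (wordCylinder w).eq_empty_or_nonempty with h | ⟨x, hx⟩
  · rw [h]; exact .empty
  · rw [wordCylinder_eq_cylinder hx]; exact measurableSet_cylinder x n

lemma ediam_wordCylinder_le {n : ℕ} (w : Fin n → Bool) :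
    Metric.ediam (wordCylinder w) ≤ (2⁻¹ : ℝ≥0∞) ^ n := by
  refine Metric.ediam_le fun x hx y hy => edist_le_of_mem_cylinder ?_
  rwa [← wordCylinder_eq_cylinder hx]

lemma two_inv_pow_rpow (n : ℕ) (s : ℝ) :
    ((2⁻¹ : ℝ≥0∞) ^ n) ^ s = ENNReal.ofReal (Real.exp (-(n * s * Real.log 2))) := by
  have h : (2⁻¹ : ℝ≥0∞) = ENNReal.ofReal 2⁻¹ := by
    rw [ENNReal.ofReal_inv_of_pos (by norm_num)]; simp
  rw [h, ← ENNReal.ofReal_pow (by norm_num), ENNReal.ofReal_rpow_of_pos (by positivity),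
    Real.rpow_def_of_pos (by positivity), Real.log_pow, Real.log_inv]
  congr 2; ring

/-- Mass distribution principle on the dyadic Cantor set. -/
lemma measure_le_hausdorffMeasure {μ : Measure Cantor} {F : Set Cantor} (hF : MeasurableSet F)
    {s : ℝ} (hs : 0 < s) (N : ℕ)
    (h : ∀ x ∈ F, ∀ n ≥ N, μ (PiNat.cylinder x n) ≤ ((2⁻¹ : ℝ≥0∞) ^ n) ^ s) :
    μ F ≤ Measure.hausdorffMeasure s F := by
  have key : μ.restrict F ≤ Measure.hausdorffMeasure s := by
    refine Measure.le_hausdorffMeasure s _ ((2⁻¹ : ℝ≥0∞) ^ N)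
      (pos_iff_ne_zero.2 (pow_ne_zero _ (by simp))) fun t ht => ?_
    rw [Measure.restrict_apply' hF]
    rcases (t ∩ F).eq_empty_or_nonempty with he | ⟨x, hxt, hxF⟩
    · simp [he]
    -- A single point has diameter `0`, so no generation matches it; its mass is killed by shrinking
    -- cylinders, which is where `0 < s` enters.
    by_cases hsub : t.Subsingleton
    · have h0 : μ (t ∩ F) ≤ 0 := by
        have hlim : Tendsto (fun n : ℕ => ((2⁻¹ : ℝ≥0∞) ^ n) ^ s) atTop (𝓝 0) := by
          have h1 : Tendsto (fun n : ℕ => (2⁻¹ : ℝ≥0∞) ^ n) atTop (𝓝 0) :=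
            ENNReal.tendsto_pow_atTop_nhds_zero_of_lt_one (by simp)
          have h2 := (ENNReal.continuous_rpow_const (y := s)).tendsto 0 |>.comp h1
          rwa [ENNReal.zero_rpow_of_pos hs] at h2
        refine ge_of_tendsto hlim ((eventually_ge_atTop N).mono fun n hn => ?_)
        refine (measure_mono fun y hy => ?_).trans (h x hxF n hn)
        rw [hsub hy.1 hxt]; exact PiNat.self_mem_cylinder x n
      exact h0.trans zero_le
    · rw [Set.not_subsingleton_iff] at hsub
      -- The least generation at which two points of `t` separate gives a cylinder containing `t`
      -- whose scale `2⁻ⁿ` is at most the diameter of `t`.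
      have hex : ∃ n, ∃ y ∈ t, ∃ z ∈ t, y ≠ z ∧ PiNat.firstDiff y z = n := by
        obtain ⟨y, hy, z, hz, hne⟩ := hsub
        exact ⟨_, y, hy, z, hz, hne, rfl⟩
      classical
      obtain ⟨y, hy, z, hz, hne, hn⟩ := Nat.find_spec hex
      set n := Nat.find hex
      have hd : (2⁻¹ : ℝ≥0∞) ^ n ≤ Metric.ediam t := by
        rw [← hn, ← edist_eq_of_ne hne]
        exact Metric.edist_le_ediam_of_mem hy hz
      have hNn : N ≤ n := by
        by_contra hlt
        push Not at hlt
        exact absurd (hd.trans ht) (not_le.2 (by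
          rw [← ENNReal.inv_pow, ← ENNReal.inv_pow, ENNReal.inv_lt_inv]
          exact_mod_cast Nat.pow_lt_pow_right (by norm_num) hlt))
      calc μ (t ∩ F) ≤ μ (PiNat.cylinder x n) := by
            refine measure_mono fun w hw => ?_
            rcases eq_or_ne w x with rfl | hwx
            · exact PiNat.self_mem_cylinder w n
            · rw [PiNat.mem_cylinder_iff_le_firstDiff hwx]
              exact Nat.find_min' hex ⟨w, hw.1, x, hxt, hwx, rfl⟩
        _ ≤ ((2⁻¹ : ℝ≥0∞) ^ n) ^ s := h x hxF n hNn
        _ ≤ _ := ENNReal.rpow_le_rpow hd hs.le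
  simpa using key F

/-! ### Box counting and packing dimension -/

lemma boxCount_le_exp {E : Set Cantor} {n : ℕ} (hn : n ≠ 0) {s : ℝ≥0}
    (h : ENNReal.ofReal (Real.log (boxCount n E) / (n * Real.log 2)) ≤ s) :
    (boxCount n E : ℝ) ≤ Real.exp (n * s * Real.log 2) := by
  have hl : 0 < Real.log 2 := Real.log_pos (by norm_num)
  have hn' : (0 : ℝ) < n := by exact_mod_cast Nat.pos_of_ne_zero hn
  rcases Nat.eq_zero_or_pos (boxCount n E) with h0 | h0
  · rw [h0]; simpa using (Real.exp_pos _).le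
  have h := (ENNReal.ofReal_le_iff_le_toReal ENNReal.coe_ne_top).1 h
  rw [ENNReal.coe_toReal, div_le_iff₀ (by positivity)] at h
  rw [← Real.log_le_iff_le_exp (by exact_mod_cast h0)]
  linarith

/-- For `s` above the box dimension, the cylinders of generation `n` meeting `E` number at most `2 ^
(n s)`, so these covers bound the `s`-dimensional Hausdorff measure by `1`. -/
lemma dimH_le_upperBoxDim (E : Set Cantor) : dimH E ≤ upperBoxDim E := by
  classical
  refine ENNReal.le_of_forall_pos_le_add fun ε hε hfin => ?_
  lift upperBoxDim E to ℝ≥0 using hfin.ne with b hb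
  have hlt : upperBoxDim E < ((b + ε : ℝ≥0) : ℝ≥0∞) := by
    rw [← hb]; exact_mod_cast lt_add_of_pos_right b hε
  rw [← ENNReal.coe_add]
  set s : ℝ≥0 := b + ε
  have hev := eventually_lt_of_limsup_lt hlt
  refine dimH_le_of_hausdorffMeasure_ne_top (ne_top_of_le_ne_top ENNReal.one_ne_top ?_)
  have hcov := Measure.hausdorffMeasure_le_liminf_sum (l := atTop)
    (ι := fun n : ℕ => {w : Fin n → Bool // (E ∩ wordCylinder w).Nonempty}) (s : ℝ) E
    (fun n => (2⁻¹ : ℝ≥0∞) ^ n)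
    (ENNReal.tendsto_pow_atTop_nhds_zero_of_lt_one (by simp)) (fun n w => wordCylinder w.1)
    (Eventually.of_forall fun n w => ediam_wordCylinder_le _)
    (Eventually.of_forall fun n x hx => Set.mem_iUnion.2
      ⟨⟨_, x, hx, mem_wordCylinder_self n x⟩, mem_wordCylinder_self n x⟩)
  refine hcov.trans (liminf_le_of_frequently_le' (Eventually.frequently ?_))
  filter_upwards [hev, eventually_ne_atTop 0] with n hn hn0
  calc _ ≤ ∑ _w : {w : Fin n → Bool // (E ∩ wordCylinder w).Nonempty},
          ((2⁻¹ : ℝ≥0∞) ^ n) ^ (s : ℝ) :=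
        Finset.sum_le_sum fun w _ => ENNReal.rpow_le_rpow (ediam_wordCylinder_le _) s.2
    _ = ENNReal.ofReal ((boxCount n E : ℝ) * Real.exp (-(n * s * Real.log 2))) := by
        rw [Finset.sum_const, two_inv_pow_rpow, nsmul_eq_mul, Finset.card_univ,
          ENNReal.ofReal_mul (Nat.cast_nonneg _), ENNReal.ofReal_natCast, boxCount,
          ← Nat.card_coe_set_eq, Nat.card_eq_fintype_card]
        rfl
    _ ≤ 1 := by
        rw [← ENNReal.ofReal_one]
        apply ENNReal.ofReal_le_ofReal
        rw [Real.exp_neg, ← div_eq_mul_inv, div_le_one (Real.exp_pos _)]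
        exact boxCount_le_exp hn0 hn.le

lemma dimH_le_packingDim (E : Set Cantor) : dimH E ≤ packingDim E :=
  le_iInf₂ fun F hF => calc
    dimH E ≤ dimH (⋃ i, F i) := dimH_mono hF
    _ = ⨆ i, dimH (F i) := dimH_iUnion F
    _ ≤ ⨆ i, upperBoxDim (F i) := iSup_mono fun _ => dimH_le_upperBoxDim _

lemma packingDim_iUnion_le (F : ℕ → Set Cantor) : packingDim (⋃ i, F i) ≤ ⨆ i, upperBoxDim (F i) :=
  iInf_le_of_le F (iInf_le_of_le (Set.Subset.refl _) le_rfl)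

lemma sum_measureReal_wordCylinder_le_one (μ : Measure Cantor) [IsProbabilityMeasure μ] {n : ℕ}
    (S : Finset (Fin n → Bool)) : ∑ w ∈ S, μ.real (wordCylinder w) ≤ 1 := by
  rw [← measureReal_biUnion_finset _ fun w _ => measurableSet_wordCylinder w]
  · exact measureReal_le_one
  · intro v _ w _ hvw
    refine Set.disjoint_left.2 fun x hv hw => hvw ?_
    ext i
    rw [← hv i, ← hw i]

/-- A set all of whose points see large cylinders has small upper box dimension. -/
lemma upperBoxDim_le {μ : Measure Cantor} [IsProbabilityMeasure μ] {F : Set Cantor} {s : ℝ} (N : ℕ)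
    (h : ∀ x ∈ F, ∀ n ≥ N, Real.exp (-(n * s * Real.log 2)) ≤ mass μ n x) :
    upperBoxDim F ≤ ENNReal.ofReal s := by
  classical
  refine limsup_le_of_le (by isBoundedDefault) ?_
  filter_upwards [eventually_ge_atTop N, eventually_gt_atTop 0] with n hn hn0
  have hl : 0 < Real.log 2 := Real.log_pos (by norm_num)
  have hn' : (0 : ℝ) < n := by exact_mod_cast hn0
  rcases Nat.eq_zero_or_pos (boxCount n F) with h0 | h0
  · simp [h0]
  apply ENNReal.ofReal_le_ofReal
  rw [div_le_iff₀ (by positivity), Real.log_le_iff_le_exp (by exact_mod_cast h0)]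
  have hcard : boxCount n F
      = (Finset.univ.filter fun w : Fin n → Bool => (F ∩ wordCylinder w).Nonempty).card := by
    rw [boxCount, ← Set.ncard_coe_finset]; simp
  have hsum := sum_measureReal_wordCylinder_le_one μ
    (Finset.univ.filter fun w : Fin n → Bool => (F ∩ wordCylinder w).Nonempty)
  -- Disjoint cylinders, each of mass at least `2 ^ (-n s)`, number at most `2 ^ (n s)`.
  have hle := Finset.card_nsmul_le_sum
    (Finset.univ.filter fun w : Fin n → Bool => (F ∩ wordCylinder w).Nonempty)
    (fun w => μ.real (wordCylinder w)) (Real.exp (-(n * s * Real.log 2))) (fun w hw => by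
      obtain ⟨x, hxF, hxw⟩ := (Finset.mem_filter.1 hw).2
      rw [wordCylinder_eq_cylinder hxw]
      exact h x hxF n hn)
  rw [nsmul_eq_mul, ← hcard] at hle
  have := hle.trans hsum
  rw [Real.exp_neg, ← div_eq_mul_inv, div_le_one (Real.exp_pos _)] at this
  exact this.trans_eq (by congr 1; ring)

/-! ### From local entropies to dimensions -/

section LocalEntropy

variable {μ : Measure Cantor} {d : ℝ}

lemma mass_zero [IsProbabilityMeasure μ] (x : Cantor) : mass μ 0 x = 1 := by
  simp [mass]

lemma mass_le_one [IsProbabilityMeasure μ] (n : ℕ) (x : Cantor) : mass μ n x ≤ 1 := measureReal_le_one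

/-- Masses decay at most geometrically. This makes them positive and bounds the local entropies
uniformly by `log C`. -/
lemma IsDyadicDoubling.exists_one_le_pow_mul_mass [IsProbabilityMeasure μ] (h : IsDyadicDoubling μ) :
    ∃ C : ℝ, 1 ≤ C ∧ ∀ n x, 1 ≤ C ^ n * mass μ n x := by
  obtain ⟨C, hC⟩ := h
  refine ⟨max C 1, le_max_right _ _, fun n x => ?_⟩
  induction n with
  | zero => simp [mass_zero]
  | succ n ih =>
    have h1 : mass μ n x ≤ C * mass μ (n + 1) x := by
      have := ENNReal.toReal_mono (by finiteness) (hC n x)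
      simpa [mass, measureReal_def] using this
    have h2 : mass μ n x ≤ max (C : ℝ) 1 * mass μ (n + 1) x :=
      h1.trans (mul_le_mul_of_nonneg_right (le_max_left _ _) measureReal_nonneg)
    calc 1 ≤ max (C : ℝ) 1 ^ n * mass μ n x := ih
      _ ≤ max (C : ℝ) 1 ^ n * (max (C : ℝ) 1 * mass μ (n + 1) x) := by gcongr
      _ = _ := by ring

lemma IsDyadicDoubling.mass_pos [IsProbabilityMeasure μ] (h : IsDyadicDoubling μ) (n : ℕ) (x : Cantor) :
    0 < mass μ n x := by
  obtain ⟨C, hC1, hC⟩ := h.exists_one_le_pow_mul_mass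
  exact pos_of_mul_pos_right (one_pos.trans_le (hC n x)) (by positivity)

lemma mass_eq_wordCylinder (n : ℕ) (x : Cantor) :
    mass μ n x = μ.real (wordCylinder fun i : Fin n => x i) := by
  rw [mass, wordCylinder_eq_cylinder (mem_wordCylinder_self n x)]

lemma measurable_prefix (n : ℕ) : Measurable fun (x : Cantor) (i : Fin n) => x i := by
  fun_prop

lemma measurable_mass (n : ℕ) : Measurable (mass μ n) := by
  have : mass μ n = (fun w : Fin n → Bool => μ.real (wordCylinder w)) ∘ fun x i => x i :=
    funext fun x => mass_eq_wordCylinder n x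
  rw [this]
  exact Measurable.of_discrete.comp (measurable_prefix n)

lemma entropy_eq_integral [IsProbabilityMeasure μ] (n : ℕ) :
    entropy μ n = ∫ x, -Real.log (mass μ n x) / n ∂μ := by
  have h : ∫ x, Real.log (mass μ n x) ∂μ
      = ∑ w : Fin n → Bool, Real.log (μ.real (wordCylinder w)) * μ.real (wordCylinder w) := by
    simp_rw [mass_eq_wordCylinder]
    rw [← integral_map (φ := fun (x : Cantor) (i : Fin n) => x i)
      (f := fun w => Real.log (μ.real (wordCylinder w)))
      (measurable_prefix n).aemeasurable Measurable.of_discrete.aestronglyMeasurable]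
    have := Measure.isProbabilityMeasure_map (μ := μ) (measurable_prefix n).aemeasurable
    rw [integral_fintype .of_finite]
    refine Finset.sum_congr rfl fun w _ => ?_
    rw [map_measureReal_apply (measurable_prefix n) (measurableSet_singleton w), smul_eq_mul,
      mul_comm]
    congr 2
    ext x
    simp [wordCylinder, funext_iff]
  rw [entropy, ← h, integral_div, integral_neg]
  ring

/-- If the local entropies converge almost everywhere, so do the normalized entropies. -/
lemma tendsto_entropy [IsProbabilityMeasure μ] (hd : IsDyadicDoubling μ)
    (h : ∀ᵐ x ∂μ, Tendsto (fun n : ℕ => -Real.log (mass μ n x) / n) atTop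
      (𝓝 (d * Real.log 2))) :
    Tendsto (entropy μ) atTop (𝓝 (d * Real.log 2)) := by
  obtain ⟨C, hC1, hC⟩ := hd.exists_one_le_pow_mul_mass
  have hint : Tendsto (fun n : ℕ => ∫ x, -Real.log (mass μ n x) / n ∂μ) atTop
      (𝓝 (∫ _, d * Real.log 2 ∂μ)) := by
    refine tendsto_integral_of_dominated_convergence (fun _ => Real.log C) (fun n => ?_)
      (integrable_const _) (fun n => Eventually.of_forall fun x => ?_) h
    · exact (((measurable_mass n).log.neg).div_const _).aestronglyMeasurable
    · have hm := hd.mass_pos n x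
      have h1 : Real.log (mass μ n x) ≤ 0 := Real.log_nonpos hm.le (mass_le_one n x)
      have h2 : 0 ≤ n * Real.log C + Real.log (mass μ n x) := by
        rw [← Real.log_pow, ← Real.log_mul (by positivity) hm.ne']
        exact Real.log_nonneg (hC n x)
      rw [Real.norm_eq_abs, abs_of_nonneg (div_nonneg (by linarith) (Nat.cast_nonneg n))]
      exact div_le_of_le_mul₀ (Nat.cast_nonneg n) (Real.log_nonneg hC1) (by linarith)
  simp_rw [← entropy_eq_integral] at hint
  simpa using hint

/-- For each `s > d`, almost every point has cylinders of mass at least `2 ^ (-n s)` from some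
generation `N` on. Sorting points by `N` gives countably many sets of upper box dimension at most
`s`; then `s` decreases to `d`. -/
lemma upperPackingDim_le [IsProbabilityMeasure μ] (hd : IsDyadicDoubling μ)
    (h : ∀ᵐ x ∂μ, Tendsto (fun n : ℕ => -Real.log (mass μ n x) / n) atTop
      (𝓝 (d * Real.log 2))) :
    upperPackingDim μ ≤ ENNReal.ofReal d := by
  have hl : 0 < Real.log 2 := Real.log_pos (by norm_num)
  have key : ∀ s > d, upperPackingDim μ ≤ ENNReal.ofReal s := by
    intro s hs
    let F : ℕ → Set Cantor := fun N =>
      {x | ∀ n ≥ N, Real.exp (-(n * s * Real.log 2)) ≤ mass μ n x}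
    have hFm : ∀ N, MeasurableSet (F N) := fun N => by
      have : F N = ⋂ n, ⋂ (_ : n ≥ N), {x | Real.exp (-(n * s * Real.log 2)) ≤ mass μ n x} := by
        ext x; simp [F]
      rw [this]
      exact .iInter fun n => .iInter fun _ => measurableSet_le measurable_const (measurable_mass n)
    suffices hfull : μ (⋃ N, F N)ᶜ = 0 by
      have hle : upperPackingDim μ ≤ packingDim (⋃ N, F N) :=
        iInf_le_of_le _ (iInf_le_of_le (MeasurableSet.iUnion hFm) (iInf_le_of_le hfull le_rfl))
      exact hle.trans ((packingDim_iUnion_le F).trans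
        (iSup_le fun N => upperBoxDim_le N fun x hx => hx))
    rw [← mem_ae_iff]
    filter_upwards [h] with x hx
    have hev := hx.eventually_lt_const (mul_lt_mul_of_pos_right hs hl)
    -- Generation `0` is excluded in order to clear the denominator `n`.
    obtain ⟨N, hN⟩ := eventually_atTop.1 (hev.and (eventually_gt_atTop 0))
    refine Set.mem_iUnion.2 ⟨N, fun n hn => ?_⟩
    obtain ⟨h1, h2⟩ := hN n hn
    have h2' : (0 : ℝ) < n := by exact_mod_cast h2
    rw [div_lt_iff₀ h2'] at h1
    rw [← Real.le_log_iff_exp_le (hd.mass_pos n x)]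
    linarith
  refine ge_of_tendsto (x := 𝓝[>] d) (f := fun s => ENNReal.ofReal s)
    (ENNReal.continuous_ofReal.continuousWithinAt) ?_
  filter_upwards [self_mem_nhdsWithin] with s hs using key s hs

/-- If `s < d`, the points whose cylinders have mass at most `2 ^ (-n s)` from generation `N` on
exhaust almost everything as `N` grows. One of these sets meets `E` in positive measure, and the
mass distribution principle applies to the intersection. -/
lemma ofReal_le_lowerDim [IsProbabilityMeasure μ] (hd : IsDyadicDoubling μ)
    (h : ∀ᵐ x ∂μ, Tendsto (fun n : ℕ => -Real.log (mass μ n x) / n) atTop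
      (𝓝 (d * Real.log 2))) :
    ENNReal.ofReal d ≤ lowerDim μ := by
  have hl : 0 < Real.log 2 := Real.log_pos (by norm_num)
  refine le_iInf fun E => le_iInf fun hE => le_iInf fun hpos => ?_
  refine le_of_forall_lt_imp_le_of_dense fun c hc => ?_
  lift c to ℝ≥0 using hc.ne_top with s
  rcases eq_zero_or_pos s with rfl | hs0
  · simp
  have hsd : (s : ℝ) < d := by
    rwa [ENNReal.ofReal, ENNReal.coe_lt_coe, Real.lt_toNNReal_iff_coe_lt] at hc
  let F : ℕ → Set Cantor := fun N =>
    {x | ∀ n ≥ N, mass μ n x ≤ Real.exp (-(n * s * Real.log 2))}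
  have hFm : ∀ N, MeasurableSet (F N) := fun N => by
    have : F N = ⋂ n, ⋂ (_ : n ≥ N), {x | mass μ n x ≤ Real.exp (-(n * s * Real.log 2))} := by
      ext x; simp [F]
    rw [this]
    exact .iInter fun n => .iInter fun _ => measurableSet_le (measurable_mass n) measurable_const
  have hfull : ∀ᵐ x ∂μ, x ∈ ⋃ N, F N := by
    filter_upwards [h] with x hx
    have hev := hx.eventually_const_lt (mul_lt_mul_of_pos_right hsd hl)
    obtain ⟨N, hN⟩ := eventually_atTop.1 (hev.and (eventually_gt_atTop 0))
    refine Set.mem_iUnion.2 ⟨N, fun n hn => ?_⟩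
    obtain ⟨h1, h2⟩ := hN n hn
    have h2' : (0 : ℝ) < n := by exact_mod_cast h2
    rw [lt_div_iff₀ h2'] at h1
    rw [← Real.log_le_iff_le_exp (hd.mass_pos n x)]
    linarith
  obtain ⟨N, hN⟩ : ∃ N, 0 < μ (E ∩ F N) := by
    by_contra! hcon
    have h0 : μ (⋃ N, E ∩ F N) = 0 := measure_iUnion_null fun N => le_antisymm (hcon N) zero_le
    rw [← Set.inter_iUnion] at h0
    refine hpos.ne' (measure_mono_null (fun x hx => ?_)
      (measure_union_null h0 (mem_ae_iff.1 hfull)))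
    by_cases hxU : x ∈ ⋃ N, F N
    exacts [Or.inl ⟨hx, hxU⟩, Or.inr hxU]
  have hmd := measure_le_hausdorffMeasure (μ := μ) (hE.inter (hFm N)) (s := s) (by exact_mod_cast hs0) N
    fun x hx n hn => by
      rw [two_inv_pow_rpow, ← ofReal_measureReal]
      exact ENNReal.ofReal_le_ofReal (hx.2 n hn)
  exact (le_dimH_of_hausdorffMeasure_ne_zero (hN.trans_le hmd).ne').trans
    (dimH_mono Set.inter_subset_left)

lemma lowerDim_le_upperDim [IsProbabilityMeasure μ] : lowerDim μ ≤ upperDim μ :=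
  le_iInf fun E => le_iInf fun hE => le_iInf fun h => iInf_le_of_le E (iInf_le_of_le hE
    (iInf_le_of_le (by rw [(prob_compl_eq_zero_iff hE).1 h]; exact one_pos) le_rfl))

lemma upperDim_le_upperPackingDim : upperDim μ ≤ upperPackingDim μ :=
  iInf_mono fun E => iInf_mono fun _ => iInf_mono fun _ => dimH_le_packingDim E

lemma lowerDim_le_lowerPackingDim : lowerDim μ ≤ lowerPackingDim μ :=
  iInf_mono fun E => iInf_mono fun _ => iInf_mono fun _ => dimH_le_packingDim E

lemma lowerPackingDim_le_upperPackingDim [IsProbabilityMeasure μ] : lowerPackingDim μ ≤ upperPackingDim μ :=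
  le_iInf fun E => le_iInf fun hE => le_iInf fun h => iInf_le_of_le E (iInf_le_of_le hE
    (iInf_le_of_le (by rw [(prob_compl_eq_zero_iff hE).1 h]; exact one_pos) le_rfl))

/-- If the local entropies of a doubling measure converge to a constant almost everywhere, then
all dimensions and entropies are given by this constant. -/
theorem dimensions_of_tendsto_localEntropy [IsProbabilityMeasure μ] (hd : IsDyadicDoubling μ)
    (h : ∀ᵐ x ∂μ, Tendsto (fun n : ℕ => -Real.log (mass μ n x) / n) atTop
      (𝓝 (d * Real.log 2))) :
    lowerDim μ = ENNReal.ofReal d ∧ IsExact μ ∧ DimensionsEqEntropies μ := by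
  have hl : 0 < Real.log 2 := Real.log_pos (by norm_num)
  have hup := upperPackingDim_le hd h
  have hlow := ofReal_le_lowerDim hd h
  have hent := tendsto_entropy hd h
  have e1 : lowerDim μ = ENNReal.ofReal d := le_antisymm
    (lowerDim_le_upperDim.trans (upperDim_le_upperPackingDim.trans hup)) hlow
  have e2 : upperDim μ = ENNReal.ofReal d := le_antisymm
    (upperDim_le_upperPackingDim.trans hup) (hlow.trans lowerDim_le_upperDim)
  have e3 : lowerPackingDim μ = ENNReal.ofReal d := le_antisymm
    (lowerPackingDim_le_upperPackingDim.trans hup) (hlow.trans lowerDim_le_lowerPackingDim)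
  have e4 : upperPackingDim μ = ENNReal.ofReal d := le_antisymm hup
    (e3.ge.trans lowerPackingDim_le_upperPackingDim)
  refine ⟨e1, e1.trans e2.symm, ⟨e1.trans e2.symm, ?_⟩, e3.trans e4.symm, ?_⟩
  · rw [e2, lowerEntropy, hent.liminf_eq, mul_div_cancel_right₀ _ hl.ne']
  · rw [e4, upperEntropy, hent.limsup_eq, mul_div_cancel_right₀ _ hl.ne']

end LocalEntropy

/-! ### Cesàro averages and the law of large numbers -/

section Averages

lemma tendsto_average_of_even_odd {v : ℕ → ℝ} {a b : ℝ}
    (ha : Tendsto (fun n : ℕ => (∑ k ∈ Finset.range n, v (2 * k)) / n) atTop (𝓝 a))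
    (hb : Tendsto (fun n : ℕ => (∑ k ∈ Finset.range n, v (2 * k + 1)) / n) atTop (𝓝 b)) :
    Tendsto (fun n : ℕ => (∑ i ∈ Finset.range n, v i) / n) atTop (𝓝 ((a + b) / 2)) := by
  -- Below `n` there are `(n + 1) / 2` even and `n / 2` odd indices.
  have hsplit : ∀ n, ∑ i ∈ Finset.range n, v i = ∑ k ∈ Finset.range ((n + 1) / 2), v (2 * k)
      + ∑ k ∈ Finset.range (n / 2), v (2 * k + 1) := by
    intro n
    induction n with
    | zero => simp
    | succ n ih =>
      rw [Finset.sum_range_succ, ih]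
      rcases Nat.even_or_odd' n with ⟨m, rfl | rfl⟩
      · rw [show (2 * m + 1 + 1) / 2 = m + 1 by omega, show (2 * m + 1) / 2 = m by omega,
          show 2 * m / 2 = m by omega, Finset.sum_range_succ]
        ring
      · rw [show (2 * m + 1 + 1 + 1) / 2 = m + 1 by omega,
          show (2 * m + 1 + 1) / 2 = m + 1 by omega, show (2 * m + 1) / 2 = m by omega,
          Finset.sum_range_succ (fun k => v (2 * k + 1))]
        ring
  have hlim : ∀ e : ℕ, Tendsto (fun n : ℕ => (((n + e) / 2 : ℕ) : ℝ) / n) atTop (𝓝 (1 / 2)) := by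
    intro e
    have h1 : Tendsto (fun n : ℕ => ((e : ℝ) + 1) / n) atTop (𝓝 0) :=
      tendsto_const_div_atTop_nhds_zero_nat _
    refine tendsto_of_tendsto_of_tendsto_of_le_of_le'
      (g := fun n : ℕ => 1 / 2 - ((e : ℝ) + 1) / n) (h := fun n : ℕ => 1 / 2 + ((e : ℝ) + 1) / n)
      (by simpa using tendsto_const_nhds.sub h1) (by simpa using tendsto_const_nhds.add h1) ?_ ?_
    all_goals
      filter_upwards [eventually_gt_atTop 0] with n hn
      have hn' : (0 : ℝ) < n := by exact_mod_cast hn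
      have h2 : n + e ≤ 2 * ((n + e) / 2) + 1 := by omega
      have h3 : 2 * ((n + e) / 2) ≤ n + e := by omega
      have h2' : (n : ℝ) + e ≤ 2 * (((n + e) / 2 : ℕ) : ℝ) + 1 := by exact_mod_cast h2
      have h3' : 2 * (((n + e) / 2 : ℕ) : ℝ) ≤ n + e := by exact_mod_cast h3
      have he : (0 : ℝ) ≤ e := Nat.cast_nonneg e
    · rw [sub_le_iff_le_add, ← add_div, le_div_iff₀ hn']; linarith
    · rw [div_le_iff₀ hn', add_mul, div_mul_cancel₀ _ hn'.ne']; linarith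
  have hhalf : ∀ e : ℕ, Tendsto (fun n : ℕ => (n + e) / 2) atTop atTop := fun e =>
    tendsto_atTop.2 fun m => (eventually_ge_atTop (2 * m)).mono fun n hn => by omega
  have hA := (ha.comp (hhalf 1)).mul (hlim 1)
  have hB := (hb.comp (hhalf 0)).mul (hlim 0)
  have key : ∀ (S : ℕ → ℝ) (m n : ℕ), S 0 = 0 → S m / m * (m / n) = S m / n := by
    intro S m n h0
    rcases Nat.eq_zero_or_pos m with rfl | hm
    · simp [h0]
    · have : (m : ℝ) ≠ 0 := by exact_mod_cast hm.ne'
      rw [div_mul_div_comm, mul_comm (S m), mul_div_mul_left _ _ this]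
  convert hA.add hB using 2
  · rename_i n
    simp only [Function.comp_def]
    rw [key (fun m => ∑ k ∈ Finset.range m, v (2 * k)) _ _ (by simp),
      key (fun m => ∑ k ∈ Finset.range m, v (2 * k + 1)) _ _ (by simp), hsplit, add_div, add_zero]
  · ring

lemma tendsto_average_congr {u v : ℕ → ℝ} {a : ℝ} (h : ∀ᶠ n in atTop, u n = v n)
    (hv : Tendsto (fun n : ℕ => (∑ i ∈ Finset.range n, v i) / n) atTop (𝓝 a)) :
    Tendsto (fun n : ℕ => (∑ i ∈ Finset.range n, u i) / n) atTop (𝓝 a) := by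
  have h0 : Tendsto (fun n => u n - v n) atTop (𝓝 0) :=
    tendsto_const_nhds.congr' (h.mono fun n hn => by simp [hn])
  convert h0.cesaro.add hv using 2
  · rw [Finset.sum_sub_distrib]; ring
  · simp

/-- Distinct coordinates of a product measure are independent, so the strong law applies along any
injective selection of coordinates with a common law. -/
lemma ae_tendsto_average_infinitePi {ι : Type*} {P : ι → Measure Bool}
    [∀ i, IsProbabilityMeasure (P i)] {j : ℕ → ι} (hj : Function.Injective j) {ν : Measure Bool}
    (hν : ∀ k, P (j k) = ν) (f : Bool → ℝ) {a : ℝ} (ha : a = ∫ b, f b ∂ν) :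
    ∀ᵐ ω ∂Measure.infinitePi P,
      Tendsto (fun n : ℕ => (∑ k ∈ Finset.range n, f (ω (j k))) / n) atTop (𝓝 a) := by
  have hf : Measurable f := .of_discrete
  have hm : ∀ k, Measurable fun ω : ι → Bool => f (ω (j k)) := fun k =>
    hf.comp (measurable_pi_apply _)
  have hev : ∀ k, (Measure.infinitePi P).map (fun ω => ω (j k)) = ν := fun k =>
    (Measure.infinitePi_map_eval P (j k)).trans (hν k)
  have hmap : ∀ k, (Measure.infinitePi P).map (fun ω => f (ω (j k))) = ν.map f := fun k => by
    rw [← hev k, Measure.map_map hf (measurable_pi_apply _)]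
    rfl
  have hmean : ∫ b, f b ∂ν = ∫ ω, f (ω (j 0)) ∂Measure.infinitePi P := by
    rw [← hev 0, integral_map (measurable_pi_apply _).aemeasurable hf.aestronglyMeasurable]
  have hind := ProbabilityTheory.iIndepFun_infinitePi (P := P) (X := fun _ => f) fun _ => hf
  have hfin : IsProbabilityMeasure ν := hν 0 ▸ inferInstance
  have hint : Integrable f ν := .of_finite
  have hint' : Integrable (fun ω : ι → Bool => f (ω (j 0))) (Measure.infinitePi P) := by
    rw [← hev 0] at hint
    exact hint.comp_measurable (measurable_pi_apply _)
  rw [ha, hmean]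
  exact ProbabilityTheory.strong_law_ae_real (μ := Measure.infinitePi P)
    (fun k ω => f (ω (j k))) hint'
    (fun k l hkl => hind.indepFun (hj.ne hkl))
    (fun k => ⟨(hm k).aemeasurable, (hm 0).aemeasurable, (hmap k).trans (hmap 0).symm⟩)

end Averages

/-! ### The steered measures -/

section Steering

open ProbabilityTheory unitInterval

/-- The probability of the digit `1` under each coin: the digits at even positions are control bits
of bias `c`, those at odd positions are tossed with a fair coin in the state `true` and with a coin
of bias `p` in the state `false`. -/
noncomputable def bias (c p : I) (j : ℕ × Bool) : I :=
  if Even j.1 then c else if j.2 then ⟨1 / 2, by norm_num, by norm_num⟩ else p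

/-- The walk driven by the control bits. -/
noncomputable def controlSum (x : Cantor) (n : ℕ) : ℝ :=
  ∑ k ∈ Finset.range n, if x (2 * k) then 1 else -1

/-- The state that selects the coin for position `i`. -/
noncomputable def state (x : Cantor) (i : ℕ) : Bool :=
  if Even i then false else decide (0 < controlSum x (i / 2 + 1))

/-- The digit sequence obtained from a family of coins indexed by position and state. -/
noncomputable def steer (ω : ℕ × Bool → Bool) : Cantor :=
  fun i => ω (i, state (fun j => ω (j, false)) i)

/-- The law of independent coins with the prescribed biases. -/
noncomputable def coinLaw (c p : I) : Measure (ℕ × Bool → Bool) :=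
  Measure.infinitePi fun j => bernoulliMeasure true false (bias c p j)

/-- The law of the steered digit sequence. -/
noncomputable def steeredMeasure (c p : I) : Measure Cantor :=
  (coinLaw c p).map steer

/-- The probability of the digit `b` under a coin of bias `r`. -/
noncomputable def coinWeight (r : I) (b : Bool) : ℝ := if b then r else 1 - r

instance (c p : I) : IsProbabilityMeasure (coinLaw c p) :=
  inferInstanceAs (IsProbabilityMeasure (Measure.infinitePi _))

lemma controlSum_congr {x y : Cantor} {n : ℕ} (h : ∀ k < n, x (2 * k) = y (2 * k)) :
    controlSum x n = controlSum y n :=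
  Finset.sum_congr rfl fun k hk => by rw [h k (Finset.mem_range.1 hk)]

/-- The state is predictable: at position `2m + 1` the walk uses the control digits `0, 2, ..., 2m`
only. -/
lemma state_congr {x y : Cantor} {i : ℕ} (h : ∀ j < i, Even j → x j = y j) :
    state x i = state y i := by
  unfold state
  split_ifs with hi
  · rfl
  · rw [controlSum_congr fun k hk => h (2 * k) ?_ (even_two_mul k)]
    rw [Nat.not_even_iff_odd] at hi
    obtain ⟨m, rfl⟩ := hi
    omega

lemma state_of_even (x : Cantor) {i : ℕ} (hi : Even i) : state x i = false := if_pos hi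

lemma steer_of_even (ω : ℕ × Bool → Bool) {i : ℕ} (hi : Even i) : steer ω i = ω (i, false) := by
  rw [steer, state_of_even _ hi]

lemma state_steer (ω : ℕ × Bool → Bool) :
    state (steer ω) = state fun j => ω (j, false) :=
  funext fun _ => state_congr fun _ _ hj => steer_of_even ω hj

lemma steer_eq (ω : ℕ × Bool → Bool) (i : ℕ) : steer ω i = ω (i, state (steer ω) i) := by
  rw [state_steer]; rfl

lemma measurable_state (i : ℕ) : Measurable fun x : Cantor => state x i := by
  unfold state
  split_ifs with hi
  · exact measurable_const
  · refine measurable_to_bool ?_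
    have : Measurable fun x : Cantor => controlSum x (i / 2 + 1) := by
      refine Finset.measurable_fun_sum _ fun k _ => ?_
      exact (Measurable.of_discrete (f := fun b : Bool => if b then (1 : ℝ) else -1)).comp
        (measurable_pi_apply (2 * k))
    convert! measurableSet_lt (measurable_const (a := (0 : ℝ))) this using 1
    ext x
    simp

lemma measurable_steer : Measurable steer := by
  refine measurable_pi_lambda _ fun i => ?_
  have hs : Measurable fun ω : ℕ × Bool → Bool => state (fun j => ω (j, false)) i :=
    (measurable_state i).comp (measurable_pi_lambda _ fun j => measurable_pi_apply _)
  have : (fun ω => steer ω i) = fun ω : ℕ × Bool → Bool =>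
      if state (fun j => ω (j, false)) i = true then ω (i, true) else ω (i, false) := by
    ext ω
    rw [steer]
    cases state (fun j => ω (j, false)) i <;> simp
  rw [this]
  exact Measurable.ite (hs (measurableSet_singleton true)) (measurable_pi_apply _)
    (measurable_pi_apply _)

instance (c p : I) : IsProbabilityMeasure (steeredMeasure c p) :=
  Measure.isProbabilityMeasure_map measurable_steer.aemeasurable

/-- By predictability, inductively correct digits select the coins that `x` itself would select, so
the event fixes the outcomes of finitely many predetermined coins. -/
lemma steer_mem_cylinder_iff (ω : ℕ × Bool → Bool) (x : Cantor) (n : ℕ) :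
    steer ω ∈ PiNat.cylinder x n ↔ ∀ i < n, ω (i, state x i) = x i := by
  rw [PiNat.mem_cylinder_iff]
  constructor
  · intro h i hi
    rw [← h i hi, steer_eq, state_congr fun j hj _ => (h j (hj.trans hi)).symm]
  · intro h i hi
    rw [steer_eq, ← h i hi, state_congr (y := x)]
    intro j hj hje
    rw [steer_of_even ω hje, ← h j (hj.trans hi), state_of_even x hje]

lemma bernoulliMeasure_real_singleton (r : I) (b : Bool) :
    (bernoulliMeasure true false r).real {b} = coinWeight r b := by
  classical
  rw [bernoulliMeasure_real_apply r (measurableSet_singleton b)]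
  cases b <;> simp [coinWeight]

/-- The coins read along `x` sit at different positions, hence are distinct and independent. -/
lemma mass_steeredMeasure (c p : I) (n : ℕ) (x : Cantor) :
    mass (steeredMeasure c p) n x
      = ∏ i ∈ Finset.range n, coinWeight (bias c p (i, state x i)) (x i) := by
  have hpre : steer ⁻¹' PiNat.cylinder x n
      = Set.pi ((Finset.range n).image fun i => (i, state x i) : Finset (ℕ × Bool))
        fun j => {x j.1} := by
    ext ω
    simp only [Set.mem_preimage, steer_mem_cylinder_iff, Set.mem_pi, Finset.coe_image,
      Set.mem_image, Finset.coe_range, Set.mem_Iio, Set.mem_singleton_iff]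
    constructor
    · rintro h _ ⟨i, hi, rfl⟩
      exact h i hi
    · exact fun h i hi => h _ ⟨i, hi, rfl⟩
  rw [mass, steeredMeasure, map_measureReal_apply measurable_steer (measurableSet_cylinder x n),
    hpre, measureReal_def, coinLaw, Measure.infinitePi_pi _ fun _ _ => measurableSet_singleton _,
    Finset.prod_image fun i _ k _ h => congrArg Prod.fst h, ENNReal.toReal_prod]
  exact Finset.prod_congr rfl fun i _ => bernoulliMeasure_real_singleton _ _

lemma coinWeight_pos {r : I} (h0 : 0 < (r : ℝ)) (h1 : (r : ℝ) < 1) (b : Bool) :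
    0 < coinWeight r b := by
  cases b <;> simp [coinWeight, h0, h1]

variable {c p : I}

lemma bias_mem
    (hc0 : 0 < (c : ℝ)) (hc1 : (c : ℝ) < 1) (hp0 : 0 < (p : ℝ)) (hp1 : (p : ℝ) < 1)
    (j : ℕ × Bool) : 0 < (bias c p j : ℝ) ∧ (bias c p j : ℝ) < 1 := by
  unfold bias
  split_ifs
  · exact ⟨hc0, hc1⟩
  · norm_num
  · exact ⟨hp0, hp1⟩

lemma isDyadicDoubling_steeredMeasure
    (hc0 : 0 < (c : ℝ)) (hc1 : (c : ℝ) < 1) (hp0 : 0 < (p : ℝ)) (hp1 : (p : ℝ) < 1) :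
    IsDyadicDoubling (steeredMeasure c p) := by
  obtain ⟨ε, hε, hle⟩ : ∃ ε : ℝ, 0 < ε ∧ ∀ j b, ε ≤ coinWeight (bias c p j) b := by
    refine ⟨min (min (min c (1 - c)) (min p (1 - p))) (1 / 2 : ℝ), ?_, fun j b => ?_⟩
    · simp [hc0, hc1, hp0, hp1]
    · unfold bias coinWeight
      split_ifs <;> norm_num
  refine ⟨Real.toNNReal ε⁻¹, fun n x => ?_⟩
  rw [← ofReal_measureReal, ← ofReal_measureReal, ← ENNReal.ofReal,
    ← ENNReal.ofReal_mul (by positivity)]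
  apply ENNReal.ofReal_le_ofReal
  change mass _ n x ≤ ε⁻¹ * mass _ (n + 1) x
  have hm : 0 ≤ mass (steeredMeasure c p) n x := measureReal_nonneg
  rw [← div_eq_inv_mul, le_div_iff₀ hε]
  rw [mass_steeredMeasure c p (n + 1), Finset.prod_range_succ, ← mass_steeredMeasure]
  exact mul_le_mul_of_nonneg_left (hle _ _) hm

lemma weight_steeredMeasure
    (hc0 : 0 < (c : ℝ)) (hc1 : (c : ℝ) < 1) (hp0 : 0 < (p : ℝ)) (hp1 : (p : ℝ) < 1)
    (n : ℕ) (x : Cantor) :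
    weight (steeredMeasure c p) (n + 1) x = coinWeight (bias c p (n, state x n)) (x n) := by
  have hm := (isDyadicDoubling_steeredMeasure hc0 hc1 hp0 hp1).mass_pos n x
  rw [weight, Nat.add_sub_cancel, div_eq_iff hm.ne', mass_steeredMeasure c p (n + 1),
    Finset.prod_range_succ, ← mass_steeredMeasure, mul_comm]

lemma integral_neg_log_coinWeight (r : I) :
    ∫ b, -Real.log (coinWeight r b) ∂bernoulliMeasure true false r = Real.binEntropy r := by
  rw [integral_bernoulliMeasure]
  simp [coinWeight, Real.binEntropy]

/-- Almost surely the control walk drifts in the direction of the bias of the control bits. -/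
lemma ae_eventually_state (hc : (c : ℝ) ≠ 1 / 2) :
    ∀ᵐ ω ∂coinLaw c p, ∀ᶠ i in atTop,
      state (steer ω) i = if Even i then false else decide (1 / 2 < (c : ℝ)) := by
  have hlln := ae_tendsto_average_infinitePi
    (P := fun j => bernoulliMeasure true false (bias c p j)) (j := fun k => (2 * k, false))
    (fun k l h => by simpa using h) (ν := bernoulliMeasure true false c)
    -- The mean of a ±1 step is `2c - 1`, whose sign decides the drift.
    (fun k => by simp [bias]) (fun b => if b then (1 : ℝ) else -1)
    (a := 2 * c - 1) (by rw [integral_bernoulliMeasure]; simp; ring)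
  filter_upwards [hlln] with ω hω
  have hsum : ∀ n, ∑ k ∈ Finset.range n, (if ω (2 * k, false) then (1 : ℝ) else -1)
      = controlSum (steer ω) n := fun n =>
    Finset.sum_congr rfl fun k _ => by rw [steer_of_even ω (even_two_mul k)]
  simp only [hsum] at hω
  have hhalf : Tendsto (fun i : ℕ => i / 2 + 1) atTop atTop :=
    tendsto_atTop.2 fun m => (eventually_ge_atTop (2 * m)).mono fun n hn => by omega
  have hev : ∀ᶠ n in atTop, decide (0 < controlSum (steer ω) n) = decide (1 / 2 < (c : ℝ)) := by
    rcases lt_or_gt_of_ne hc with h | h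
    · filter_upwards [hω.eventually_lt_const (u := 0) (by simp; linarith)] with n hn
      rw [decide_eq_false (not_lt.2 h.le), decide_eq_false]
      intro hcon
      exact absurd hn (not_lt.2 (div_nonneg hcon.le (Nat.cast_nonneg n)))
    · filter_upwards [hω.eventually_const_lt (u := 0) (by simp; linarith)] with n hn
      rw [decide_eq_true h, decide_eq_true]
      by_contra hcon
      exact absurd hn (not_lt.2 (div_nonpos_of_nonpos_of_nonneg (not_lt.1 hcon)
        (Nat.cast_nonneg n)))
  filter_upwards [hhalf.eventually hev] with i hi
  rw [state, hi]

/-- The local entropy of the steered measure. -/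
lemma ae_tendsto_localEntropy
    (hc0 : 0 < (c : ℝ)) (hc1 : (c : ℝ) < 1) (hp0 : 0 < (p : ℝ)) (hp1 : (p : ℝ) < 1)
    (hc : (c : ℝ) ≠ 1 / 2) {h : ℝ}
    (hh : h = if 1 / 2 < (c : ℝ) then Real.log 2 else Real.binEntropy p) :
    ∀ᵐ x ∂steeredMeasure c p,
      Tendsto (fun n : ℕ => -Real.log (mass (steeredMeasure c p) n x) / n) atTop
        (𝓝 ((Real.binEntropy c + h) / 2)) := by
  have hmeas : MeasurableSet {x : Cantor |
      Tendsto (fun n : ℕ => -Real.log (mass (steeredMeasure c p) n x) / n) atTop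
        (𝓝 ((Real.binEntropy c + h) / 2))} :=
    measurableSet_tendsto _ fun n => ((measurable_mass n).log.neg).div_const _
  refine (ae_map_iff (μ := coinLaw c p) measurable_steer.aemeasurable hmeas).2 ?_
  -- `s` is the terminal state at odd positions. The coins `(2k + 1, s)` are i.i.d. whether or not
  -- they are read, so the strong law needs no conditioning on the walk.
  set s : Bool := decide (1 / 2 < (c : ℝ)) with hs
  have hodd : ∀ k, bias c p (2 * k + 1, s) = bias c p (1, s) := fun k => by
    simp [bias, Nat.not_even_bit1]
  have hentropy : Real.binEntropy (bias c p (1, s)) = h := by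
    rw [hh]
    split_ifs with h1
    · rw [hs, decide_eq_true h1, ← Real.binEntropy_two_inv]
      simp [bias]
    · rw [hs, decide_eq_false h1]
      simp [bias]
  have hA := ae_tendsto_average_infinitePi
    (P := fun j => bernoulliMeasure true false (bias c p j)) (j := fun k => (2 * k, false))
    (fun k l h => by simpa using h) (ν := bernoulliMeasure true false c)
    (fun k => by simp [bias]) (fun b => -Real.log (coinWeight c b))
    (integral_neg_log_coinWeight c).symm
  have hB := ae_tendsto_average_infinitePi
    (P := fun j => bernoulliMeasure true false (bias c p j)) (j := fun k => (2 * k + 1, s))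
    (fun k l h => by simpa using h) (ν := bernoulliMeasure true false (bias c p (1, s)))
    (fun k => by rw [hodd]) (fun b => -Real.log (coinWeight (bias c p (1, s)) b))
    (integral_neg_log_coinWeight _).symm
  rw [hentropy] at hB
  filter_upwards [hA, hB, ae_eventually_state hc] with ω hωA hωB hst
  have hlog : ∀ n : ℕ, -Real.log (mass (steeredMeasure c p) n (steer ω))
      = ∑ i ∈ Finset.range n, -Real.log (coinWeight (bias c p (i, state (steer ω) i))
          (ω (i, state (steer ω) i))) := fun n => by
    rw [mass_steeredMeasure, Real.log_prod, Finset.sum_neg_distrib]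
    · simp_rw [← steer_eq]
    · intro i _
      have hb := bias_mem hc0 hc1 hp0 hp1 (i, state (steer ω) i)
      exact (coinWeight_pos hb.1 hb.2 _).ne'
  simp_rw [hlog]
  -- The true state agrees with the terminal one from some position on, and finitely many terms do
  -- not affect averages.
  refine tendsto_average_congr (v := fun i => -Real.log (coinWeight
    (bias c p (i, if Even i then false else s)) (ω (i, if Even i then false else s))))
    (hst.mono fun i hi => by rw [hi]) (tendsto_average_of_even_odd ?_ ?_)
  · simpa [bias] using hωA
  · simpa [Nat.not_even_bit1, hodd] using hωB

/-- All dimensions and entropies of the steered measure. -/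
lemma dimensions_steeredMeasure
    (hc0 : 0 < (c : ℝ)) (hc1 : (c : ℝ) < 1) (hp0 : 0 < (p : ℝ)) (hp1 : (p : ℝ) < 1)
    (hc : (c : ℝ) ≠ 1 / 2) {h : ℝ}
    (hh : h = if 1 / 2 < (c : ℝ) then Real.log 2 else Real.binEntropy p) :
    lowerDim (steeredMeasure c p)
        = ENNReal.ofReal ((Real.binEntropy c + h) / 2 / Real.log 2) ∧
      IsExact (steeredMeasure c p) ∧ DimensionsEqEntropies (steeredMeasure c p) := by
  have hl : 0 < Real.log 2 := Real.log_pos (by norm_num)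
  refine dimensions_of_tendsto_localEntropy (isDyadicDoubling_steeredMeasure hc0 hc1 hp0 hp1) ?_
  rw [div_mul_cancel₀ _ hl.ne']
  exact ae_tendsto_localEntropy hc0 hc1 hp0 hp1 hc hh

end Steering

/-! ### Choice of parameters and conclusion -/

open unitInterval

lemma exists_binEntropy_lt : ∃ p : I, 0 < (p : ℝ) ∧ (p : ℝ) < 1 ∧
    Real.binEntropy p < Real.log 2 / 2 := by
  have hl : 0 < Real.log 2 := Real.log_pos (by norm_num)
  have h : ∀ᶠ p : ℝ in 𝓝[>] 0, Real.binEntropy p < Real.log 2 / 2 :=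
    (Real.binEntropy_continuous.continuousWithinAt (s := Set.Ioi 0) (x := 0)).eventually_lt_const
      (by simpa using hl)
  obtain ⟨p, hp, hp01⟩ := (h.and (Ioo_mem_nhdsGT (one_pos : (0 : ℝ) < 1))).exists
  exact ⟨⟨p, hp01.1.le, hp01.2.le⟩, hp01.1, hp01.2, hp⟩

lemma exists_bias_log_sub_log_lt {ε : ℝ} (hε : 0 < ε) : ∃ c : I, 1 / 2 < (c : ℝ) ∧ (c : ℝ) < 1 ∧
    |Real.log c - Real.log (1 - c)| < ε := by
  have hcont : ContinuousAt (fun c : ℝ => |Real.log c - Real.log (1 - c)|) (1 / 2) :=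
    ((Real.continuousAt_log (by norm_num)).sub
      ((continuousAt_const.sub continuousAt_id).log (by norm_num))).abs
  have h : ∀ᶠ c : ℝ in 𝓝[>] (1 / 2), |Real.log c - Real.log (1 - c)| < ε :=
    (hcont.continuousWithinAt (s := Set.Ioi (1 / 2))).eventually_lt_const (by norm_num [hε])
  obtain ⟨c, hc, hc1⟩ := (h.and (Ioo_mem_nhdsGT (by norm_num : (1 / 2 : ℝ) < 1))).exists
  exact ⟨⟨c, by linarith [hc1.1], hc1.2.le⟩, hc1.1, hc1.2, hc⟩

lemma norm_logRatio_sub_le {c p : I} (hc0 : 0 < (c : ℝ)) (hc1 : (c : ℝ) < 1) (hp0 : 0 < (p : ℝ))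
    (hp1 : (p : ℝ) < 1) (n : ℕ) (x : Cantor) :
    ‖logRatio (steeredMeasure c p) n x - logRatio (steeredMeasure (σ c) p) n x‖
      ≤ |Real.log c - Real.log (1 - c)| := by
  cases n with
  -- For `n = 0` the truncated index `n - 1` is `0`, so both weights are `1`.
  | zero => simp [logRatio, weight, mass_zero]
  | succ n =>
    have hs : ((σ c : I) : ℝ) = 1 - c := unitInterval.coe_symm_eq c
    rw [logRatio, logRatio, weight_steeredMeasure hc0 hc1 hp0 hp1,
      weight_steeredMeasure (by rw [hs]; linarith) (by rw [hs]; linarith) hp0 hp1, Real.norm_eq_abs]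
    by_cases hn : Even n
    · cases x n
      · simp [bias, hn, coinWeight, abs_sub_comm]
      · simp [bias, hn, coinWeight]
    · simp [bias, hn]

/-- The logarithm has slope at least `1` on `(0, 1]`, where the weights lie, so closeness of
log-ratios implies closeness of weights. -/
lemma norm_weight_sub_le_norm_logRatio_sub {μ ν : Measure Cantor} [IsProbabilityMeasure μ]
    [IsProbabilityMeasure ν] (hμ : IsDyadicDoubling μ) (hν : IsDyadicDoubling ν) (n : ℕ)
    (x : Cantor) : ‖weight μ n x - weight ν n x‖ₑ ≤ ‖logRatio μ n x - logRatio ν n x‖ₑ := by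
  have hpos : ∀ {m : Measure Cantor} [IsProbabilityMeasure m], IsDyadicDoubling m →
      0 < weight m n x := fun hm => div_pos (hm.mass_pos _ _) (hm.mass_pos _ _)
  have hle : ∀ {m : Measure Cantor} [IsProbabilityMeasure m], IsDyadicDoubling m →
      weight m n x ≤ 1 := fun hm => div_le_one_of_le₀
        (measureReal_mono (PiNat.cylinder_anti x (Nat.sub_le n 1))) (hm.mass_pos _ _).le
  have key : ∀ a b : ℝ, 0 < a → a ≤ b → b ≤ 1 → b - a ≤ Real.log b - Real.log a := by
    intro a b ha hab hb
    have hb0 := ha.trans_le hab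
    have h1 := Real.one_sub_inv_le_log_of_pos (div_pos hb0 ha)
    rw [Real.log_div hb0.ne' ha.ne', inv_div] at h1
    refine le_trans ?_ h1
    rw [one_sub_div hb0.ne', le_div_iff₀ hb0]
    nlinarith
  rw [enorm_le_iff_norm_le, Real.norm_eq_abs, Real.norm_eq_abs, logRatio, logRatio]
  rcases le_total (weight μ n x) (weight ν n x) with h | h
  · rw [abs_sub_comm, abs_sub_comm (Real.log _), abs_of_nonneg (sub_nonneg.2 h)]
    exact (key _ _ (hpos hμ) h (hle hν)).trans (le_abs_self _)
  · rw [abs_of_nonneg (sub_nonneg.2 h)]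
    exact (key _ _ (hpos hν) h (hle hμ)).trans (le_abs_self _)

/-- Doubling exact measures with uniformly close transition weights and distant dimensions. -/
theorem exists_close_logRatio_distant_lowerDim {ε : ℝ} (hε : 0 < ε) :
    ∃ μ ν : Measure Cantor, IsProbabilityMeasure μ ∧ IsProbabilityMeasure ν ∧
      IsDyadicDoubling μ ∧ IsDyadicDoubling ν ∧ IsExact μ ∧ IsExact ν ∧
      DimensionsEqEntropies μ ∧ DimensionsEqEntropies ν ∧
      (⨆ (n : ℕ) (x : Cantor), ‖logRatio μ n x - logRatio ν n x‖ₑ) < ENNReal.ofReal ε ∧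
      1 / 4 < |(lowerDim μ).toReal - (lowerDim ν).toReal| := by
  have hl : 0 < Real.log 2 := Real.log_pos (by norm_num)
  obtain ⟨p, hp0, hp1, hp⟩ := exists_binEntropy_lt
  obtain ⟨c, hc, hc1, hcε⟩ := exists_bias_log_sub_log_lt hε
  have hc0 : 0 < (c : ℝ) := by linarith
  have hs : ((σ c : I) : ℝ) = 1 - c := unitInterval.coe_symm_eq c
  have hs0 : 0 < ((σ c : I) : ℝ) := by rw [hs]; linarith
  have hs1 : ((σ c : I) : ℝ) < 1 := by rw [hs]; linarith
  obtain ⟨e1, x1, d1⟩ := dimensions_steeredMeasure hc0 hc1 hp0 hp1 hc.ne' (if_pos hc).symm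
  obtain ⟨e2, x2, d2⟩ := dimensions_steeredMeasure hs0 hs1 hp0 hp1 (by rw [hs]; linarith)
    (if_neg (by rw [hs]; linarith)).symm
  refine ⟨steeredMeasure c p, steeredMeasure (σ c) p, inferInstance, inferInstance,
    isDyadicDoubling_steeredMeasure hc0 hc1 hp0 hp1,
    isDyadicDoubling_steeredMeasure hs0 hs1 hp0 hp1, x1, x2, d1, d2, ?_, ?_⟩
  · refine lt_of_le_of_lt (iSup₂_le fun n x => ?_) ((ENNReal.ofReal_lt_ofReal_iff hε).2 hcε)
    rw [← ofReal_norm]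
    exact ENNReal.ofReal_le_ofReal (norm_logRatio_sub_le hc0 hc1 hp0 hp1 n x)
  · have hH := Real.binEntropy_nonneg hc0.le hc1.le
    have hHp := Real.binEntropy_nonneg hp0.le hp1.le
    rw [e1, e2, hs, Real.binEntropy_one_sub, ENNReal.toReal_ofReal (by positivity),
      ENNReal.toReal_ofReal (by positivity), ← sub_div]
    refine lt_of_lt_of_le ?_ (le_abs_self _)
    -- `H(1 - c) = H(c)`, so these terms cancel and the gap is `(log 2 - H(p)) / 2 > log 2 / 4`.
    rw [lt_div_iff₀ hl]
    linarith

end DyadicCantor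

theorem mainTheorem4 :
    (∀ ε : ℝ, 0 < ε →
      ∃ μ ν : Measure DyadicCantor.Cantor,
        IsProbabilityMeasure μ ∧ IsProbabilityMeasure ν ∧
        DyadicCantor.IsDyadicDoubling μ ∧ DyadicCantor.IsDyadicDoubling ν ∧
        DyadicCantor.IsExact μ ∧ DyadicCantor.IsExact ν ∧
        DyadicCantor.DimensionsEqEntropies μ ∧ DyadicCantor.DimensionsEqEntropies ν ∧
        (⨆ (n : ℕ) (x : DyadicCantor.Cantor),
          ‖DyadicCantor.logRatio μ n x - DyadicCantor.logRatio ν n x‖ₑ) < ENNReal.ofReal ε ∧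
        1 / 4 < |(DyadicCantor.lowerDim μ).toReal - (DyadicCantor.lowerDim ν).toReal|) ∧
    ¬ (∀ η : ℝ, 0 < η → ∃ ζ : ℝ, 0 < ζ ∧
      ∀ μ ν : Measure DyadicCantor.Cantor,
        IsProbabilityMeasure μ → IsProbabilityMeasure ν →
        DyadicCantor.IsDyadicDoubling μ → DyadicCantor.IsDyadicDoubling ν →
        DyadicCantor.IsExact μ → DyadicCantor.IsExact ν →
        (⨆ (n : ℕ) (x : DyadicCantor.Cantor),
          ‖DyadicCantor.weight μ n x - DyadicCantor.weight ν n x‖ₑ) < ENNReal.ofReal ζ →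
        |(DyadicCantor.lowerDim μ).toReal - (DyadicCantor.lowerDim ν).toReal| < η) := by
  refine ⟨fun ε hε => DyadicCantor.exists_close_logRatio_distant_lowerDim hε, fun hcont => ?_⟩
  obtain ⟨ζ, hζ, h⟩ := hcont (1 / 4) (by norm_num)
  obtain ⟨μ, ν, hμ, hν, hdμ, hdν, hxμ, hxν, -, -, hclose, hfar⟩ :=
    DyadicCantor.exists_close_logRatio_distant_lowerDim hζ
  refine (h μ ν hμ hν hdμ hdν hxμ hxν (lt_of_le_of_lt ?_ hclose)).not_gt hfar
  exact iSup₂_mono fun n x =>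
    DyadicCantor.norm_weight_sub_le_norm_logRatio_sub hdμ hdν n x
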